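/- Let $\mathbb F$ be a finite field, $I$ a finite index set and $\mathcal C\subseteq\mathbb F^I$ a linear code. For $J\subseteq I$ let $\mathcal C_J=\{\mathbf c|_J:\mathbf c\in\mathcal C,\ \mathbf c|_{I\setminus J}=\mathbf 0\}$. All graphs are finite and simple. *Realizations.* Let $\mathcal H=(V,E)$ be a connected graph and $\eta:I\to V$ a map (so $(\mathcal H,\eta)$ is a graph decomposition of $\mathcal C$, called a tree decomposition if $\mathcal H$ is a tree). Write $E(v)$ for the set of edges incident with $v$. A graphical model on $(\mathcal H,\eta)$ consists of a finite-dimensional $\mathbb F$-vector space $\mathcal S_e$ for each $e\in E$ and a subspace $C_v\subseteq\mathbb F^{\eta^{-1}(v)}\oplus\bigoplus_{e\in E(v)}\mathcal S_e$ for each $v\in V$. Its full behavior $\mathfrak B$ is the space of all $((x_i)_{i\in I},(\mathbf s_e)_{e\in E})\in\mathbb F^I\oplus\bigoplus_{e\in E}\mathcal S_e$ with $((x_i)_{i\in\eta^{-1}(v)},(\mathbf s_e)_{e\in E(v)})\in C_v$ for every $v\in V$. The model is a realization of $\mathcal C$ extending $(\mathcal H,\eta)$ if it is essential, i.e. $\mathfrak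 B$ projects onto $C_v$ for every $v\in V$ and onto $\mathcal S_e$ for every $e\in E$, and if the projection of $\mathfrak B$ to $\mathbb F^I$ is $\mathcal C$. Let $\kappa(\mathcal C;\mathcal H,\eta)$ be the minimum of $\max_{v\in V}\dim C_v$ over all such realizations. *Vertex-cut trees.* Let $\mathcal G$ be a connected graph. A vertex-cut tree of $\mathcal G$ is a pair $(T,\beta)$, where $T$ is a tree and $\beta:V(T)\to 2^{V(\mathcal G)}$, such that, with $\beta(X)=\bigcup_{x\in X}\beta(x)$ for $X\subseteq V(T)$: 1. $\beta(V(T))=V(\mathcal G)$; 2. $\beta(x)\cap\beta(y)\subseteq\beta(z)$ whenever $z$ lies on the path between $x$ and $y$ in $T$; 3. for each $z\in V(T)$, with $T_1^{(z)},\dots,T_\delta^{(z)}$ the components of $T-z$ and $V_i=\beta(V(T_i^{(z)}))\setminus\beta(z)$, the sets $\beta(z),V_1,\dots,V_\delta$ (some possibly empty) are pairwise disjoint with union $V(\mathcal G)$, and for each $i\ge 1$ every neighbour in $\mathcal G$ of a vertex of $V_i$ lies in $V_i\cup\beta(z)$. Given a graph decomposition $(\mathcal G,\omega)$ of $\mathcal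 C$ and a vertex-cut tree $(T,\beta)$ of $\mathcal G$, put, for $z\in V(T)$ and $V_1,\dots,V_\delta$ as in 3, $$m(z)=\dim\mathcal C-\sum_{i=1}^{\delta}\dim\mathcal C_{\omega^{-1}(V_i)},\qquad \mu(\mathcal C;\omega,\beta)=\max_{z\in V(T)}m(z).$$ **Proposition.** Let $(\mathcal G,\omega)$ be a graph decomposition of $\mathcal C$, with $\mathcal G$ connected, and let $(T,\beta)$ be a vertex-cut tree of $\mathcal G$. Then there is a map $\gamma:I\to V(T)$ such that $\mathcal C$ has a realization extending $(T,\gamma)$ and $$\mu(\mathcal C;\omega,\beta)=\kappa(\mathcal C;T,\gamma).$$ More precisely, some $z^*\in V(T)$ satisfies $m(z^*)=\mu(\mathcal C;\omega,\beta)$, and for every such $z^*$ the following holds. Let $\alpha(z)=\beta(z)\setminus\beta(z,z^*]$ for $z\in V(T)$, where $\beta(z,z^*]$ is the union of $\beta(y)$ over all vertices $y\neq z$ on the path from $z$ to $z^*$ in $T$ (so $\alpha(z^*)=\beta(z^*)$). Then every vertex of $\mathcal G$ lies in $\alpha(z)$ for exactly one $z\in V(T)$, and the map $\gamma:I\to V(T)$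 determined by $\omega(i)\in\alpha(\gamma(i))$ for all $i\in I$ has the stated property. -/

import Mathlib

namespace CodeGraph

universe u

section Codes

variable {F : Type u} [Field F] {I : Type*}

/-- The cross-section `C_J`: the restrictions to `J` of the codewords of `C` that vanish
outside `J`. -/
def crossSection (C : Submodule F (I → F)) (J : Set I) : Submodule F (J → F) :=
  (C ⊓ (⨅ i ∈ Jᶜ, LinearMap.ker (LinearMap.proj i : (I → F) →ₗ[F] F))).map
    (LinearMap.funLeft F F (Subtype.val : J → I))

end Codes

section Realizations

/-- A graphical model over `F` with underlying graph `G` and index mapping `ω : I → V`: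
a finite-dimensional state space `S e` for each edge `e`, and for each vertex `v` a local
constraint `C v`, a subspace of `F ^ (ω⁻¹ v) ⊕ ⨁ (e incident with v), S e`. -/
structure GraphicalModel (F : Type u) [Field F] {I V : Type*} (G : SimpleGraph V)
    (ω : I → V) where
  S : G.edgeSet → Type u
  [instAddCommGroup : ∀ e, AddCommGroup (S e)]
  [instModule : ∀ e, Module F (S e)]
  [instFinite : ∀ e, FiniteDimensional F (S e)]
  C : ∀ v : V, Submodule F
    (({i : I // ω i = v} → F) × (∀ e : {e : G.edgeSet // v ∈ (e : Sym2 V)}, S e.1))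

attribute [instance] GraphicalModel.instAddCommGroup GraphicalModel.instModule
  GraphicalModel.instFinite

namespace GraphicalModel

variable {F : Type u} [Field F] {I V : Type*} {G : SimpleGraph V} {ω : I → V}

/-- A global configuration: values of all symbol variables and all state variables. -/
abbrev GlobalConfig (Γ : GraphicalModel F G ω) : Type _ :=
  (I → F) × (∀ e : G.edgeSet, Γ.S e)

/-- The local configuration at `v` of a global configuration. -/
def localProj (Γ : GraphicalModel F G ω) (v : V) :
    Γ.GlobalConfig →ₗ[F]
      (({i : I // ω i = v} → F) × (∀ e : {e : G.edgeSet // v ∈ (e : Sym2 V)}, Γ.S e.1)) :=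
  LinearMap.prodMap (LinearMap.funLeft F F Subtype.val)
    (LinearMap.pi fun e => LinearMap.proj e.1)

/-- The state at the edge `e` of a global configuration. -/
def stateProj (Γ : GraphicalModel F G ω) (e : G.edgeSet) : Γ.GlobalConfig →ₗ[F] Γ.S e :=
  (LinearMap.proj e).comp (LinearMap.snd F (I → F) (∀ e : G.edgeSet, Γ.S e))

/-- The full behavior: the global configurations that satisfy all local constraints. -/
def behavior (Γ : GraphicalModel F G ω) : Submodule F Γ.GlobalConfig :=
  ⨅ v, (Γ.C v).comap (Γ.localProj v)

/-- Every local configuration and every state occurs in some valid global configuration. -/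
def IsEssential (Γ : GraphicalModel F G ω) : Prop :=
  (∀ v, Γ.behavior.map (Γ.localProj v) = Γ.C v) ∧
    ∀ e, Γ.behavior.map (Γ.stateProj e) = ⊤

/-- `Γ` is a graphical realization of the code `C`. -/
def IsRealization (Γ : GraphicalModel F G ω) (C : Submodule F (I → F)) : Prop :=
  Γ.IsEssential ∧
    Γ.behavior.map (LinearMap.fst F (I → F) (∀ e : G.edgeSet, Γ.S e)) = C

/-- The constraint max-complexity `max_v dim C_v` (the graph is assumed finite in use). -/
noncomputable def kappa (Γ : GraphicalModel F G ω) : ℕ :=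
  ⨆ v, Module.finrank F (Γ.C v)

end GraphicalModel

variable {F : Type u} [Field F] {I V : Type*}

/-- The set of all graphical realizations of `C` that extend the graph decomposition
`(G, ω)`. -/
def realizations (C : Submodule F (I → F)) (G : SimpleGraph V) (ω : I → V) :
    Set (GraphicalModel F G ω) :=
  {Γ | Γ.IsRealization C}

/-- `κ(C; G, ω)`, the least constraint max-complexity of a realization of `C` extending
`(G, ω)`. -/
noncomputable def kappa (C : Submodule F (I → F)) (G : SimpleGraph V) (ω : I → V) : ℕ :=
  sInf (GraphicalModel.kappa '' realizations C G ω)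

end Realizations

section VertexCutTrees

/-- `(V₀, (Vᵢ)ᵢ)` is a star partition of the vertex set of `G`: a partition, possibly with
empty parts, such that all neighbours of `Vᵢ` lie in `Vᵢ ∪ V₀`. -/
structure IsStarPartition {V ι : Type*} (G : SimpleGraph V) (V₀ : Set V) (P : ι → Set V) :
    Prop where
  disjoint_center : ∀ i, Disjoint V₀ (P i)
  pairwise_disjoint : Pairwise fun i j => Disjoint (P i) (P j)
  cover : V₀ ∪ ⋃ i, P i = Set.univ
  neighbors : ∀ i, ∀ v ∈ P i, ∀ u, G.Adj v u → u ∈ P i ∪ V₀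

variable {V W : Type*}

/-- The components of `T - z`. -/
abbrev Branch (T : SimpleGraph W) (z : W) : Type _ :=
  (T.induce ({z}ᶜ : Set W)).ConnectedComponent

/-- The vertex set, inside `V(T)`, of a component of `T - z`. -/
def Branch.verts {T : SimpleGraph W} {z : W} (c : Branch T z) : Set W :=
  Subtype.val '' c.supp

/-- `β(V(T')) \ β(z)` for a component `T'` of `T - z`. -/
def part (T : SimpleGraph W) (β : W → Set V) (z : W) (c : Branch T z) : Set V :=
  (⋃ x ∈ c.verts, β x) \ β z

/-- `(T, β)` is a vertex-cut tree of `G`. -/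
structure IsVertexCutTree (G : SimpleGraph V) (T : SimpleGraph W) (β : W → Set V) : Prop where
  isTree : T.IsTree
  cover : ⋃ z, β z = Set.univ
  inter_subset : ∀ (x y z : W) (p : T.Walk x y), p.IsPath → z ∈ p.support →
    β x ∩ β y ⊆ β z
  star : ∀ z, IsStarPartition G (β z) (part T β z)

/-- `(x, y]`: the vertices other than `x` on the path from `x` to `y` in the tree `T`. -/
def pathIoc (T : SimpleGraph W) (x y : W) : Set W :=
  {w | w ≠ x ∧ ∃ p : T.Walk x y, p.IsPath ∧ w ∈ p.support}

/-- `α(z) = β(z) \ β(z, z*]`. As `(z*, z*]` is empty here, `α(z*) = β(z*)`. -/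
def alpha (T : SimpleGraph W) (β : W → Set V) (zs z : W) : Set V :=
  β z \ ⋃ y ∈ pathIoc T z zs, β y

variable {F : Type u} [Field F] {I : Type*}

/-- `m(z) = dim C - ∑ᵢ dim C_{Jᵢ}`, the sum over the components of `T - z`, where
`Jᵢ = ω⁻¹(β(V(Tᵢ)) \ β(z))` (the tree is assumed finite in use). -/
noncomputable def mVal (C : Submodule F (I → F)) (T : SimpleGraph W) (ω : I → V)
    (β : W → Set V) (z : W) : ℤ :=
  (Module.finrank F C : ℤ) -
    ∑ᶠ c : Branch T z, (Module.finrank F (crossSection C (ω ⁻¹' part T β z c)) : ℤ)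

/-- `μ(C; ω, β) = max_z m(z)`. -/
noncomputable def mu (C : Submodule F (I → F)) (T : SimpleGraph W) (ω : I → V)
    (β : W → Set V) : ℤ :=
  ⨆ z, mVal C T ω β z

end VertexCutTrees

end CodeGraph

/-! Over a tree the least constraint dimensions are known: for any `γ`, every realization satisfies
`dim C_v ≥ dim C - ∑ dim C_{γ⁻¹(b)}`, summed over the branches `b` of `T - v`
(`IsRealization.finrank_le_add`), and one realization attains all these bounds at once
(`exists_realization_finrank_add_le`). The latter takes as state space at `e` the quotient of `C` by
the codewords that split into codewords along `e`. It remains to compare these bounds with `m`. If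
`ω i ∈ α(γ i)` for all `i`, then `ω⁻¹(V_b) ⊆ γ⁻¹(b)` for each branch `b` at each vertex, so the
bound at `z` is at most `m(z) ≤ μ`. At `z*` the inclusions are equalities, so the bound there is
`m(z*) = μ`. -/

namespace CodeGraph

/-! ### Subcodes with prescribed support and a rank inequality -/

section Codes

variable {F : Type*} [Field F] {I : Type*}

/-- Replacing by zero all coordinates outside `J`. -/
noncomputable def restrictTo (F : Type*) [Field F] {I : Type*} (J : Set I) :
    (I → F) →ₗ[F] (I → F) where
  toFun := J.indicator
  map_add' := Set.indicator_add J
  map_smul' a x := Set.indicator_const_smul J a x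

lemma restrictTo_of_mem {J : Set I} (x : I → F) {i : I} (h : i ∈ J) :
    restrictTo F J x i = x i := Set.indicator_of_mem h x

lemma restrictTo_of_notMem {J : Set I} (x : I → F) {i : I} (h : i ∉ J) :
    restrictTo F J x i = 0 := Set.indicator_of_notMem h x

/-- The subcode of the codewords that vanish outside `J`. -/
def suppSub (C : Submodule F (I → F)) (J : Set I) : Submodule F (I → F) :=
  C ⊓ (⨅ i ∈ Jᶜ, LinearMap.ker (LinearMap.proj i : (I → F) →ₗ[F] F))

lemma mem_suppSub {C : Submodule F (I → F)} {J : Set I} {x : I → F} :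
    x ∈ suppSub C J ↔ x ∈ C ∧ ∀ i ∉ J, x i = 0 := by
  simp [suppSub, Submodule.mem_iInf]

lemma suppSub_mono (C : Submodule F (I → F)) {J K : Set I} (h : J ⊆ K) :
    suppSub C J ≤ suppSub C K := fun x hx => by
  rw [mem_suppSub] at hx ⊢
  exact ⟨hx.1, fun i hi => hx.2 i fun hJ => hi (h hJ)⟩

lemma finrank_crossSection (C : Submodule F (I → F)) (J : Set I) :
    Module.finrank F (crossSection C J) = Module.finrank F (suppSub C J) := by
  have h : crossSection C J =
      LinearMap.range ((LinearMap.funLeft F F (Subtype.val : J → I)).domRestrict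
        (suppSub C J)) := (LinearMap.range_domRestrict _ _).symm
  rw [h]
  apply LinearMap.finrank_range_of_inj
  rintro ⟨x, hx⟩ ⟨y, hy⟩ hxy
  ext i
  by_cases hi : i ∈ J
  · exact congrFun hxy ⟨i, hi⟩
  · exact ((mem_suppSub.1 hx).2 i hi).trans ((mem_suppSub.1 hy).2 i hi).symm

/-- The sum of the subcodes supported on the sets of a family. -/
noncomputable def sumSupp {ι : Type*} [Fintype ι] (C : Submodule F (I → F)) (P : ι → Set I) :
    (∀ b, suppSub C (P b)) →ₗ[F] (I → F) :=
  ∑ b, (suppSub C (P b)).subtype ∘ₗ LinearMap.proj b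

lemma sumSupp_apply {ι : Type*} [Fintype ι] (C : Submodule F (I → F)) (P : ι → Set I)
    (y : ∀ b, suppSub C (P b)) : sumSupp C P y = ∑ b, (y b : I → F) := by
  simp [sumSupp, LinearMap.sum_apply]

/-- Words with disjoint supports do not interact, so the sum of the subcodes is direct. -/
lemma finrank_range_sumSupp [Finite I] {ι : Type*} [Fintype ι] (C : Submodule F (I → F))
    {P : ι → Set I} (hP : Pairwise fun a b => Disjoint (P a) (P b)) :
    Module.finrank F (LinearMap.range (sumSupp C P)) =
      ∑ b, Module.finrank F (crossSection C (P b)) := by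
  rw [LinearMap.finrank_range_of_inj, Module.finrank_pi_fintype]
  · exact Finset.sum_congr rfl fun b _ => (finrank_crossSection C (P b)).symm
  · rw [injective_iff_map_eq_zero]
    intro y hy
    funext b
    ext i
    by_cases hi : i ∈ P b
    · have h := congrFun hy i
      rw [sumSupp_apply, Finset.sum_apply, Finset.sum_eq_single b] at h
      · exact h
      · intro a _ hab
        exact (mem_suppSub.1 (y a).2).2 i fun ha => (hP hab).le_bot ⟨ha, hi⟩
      · simp
    · exact (mem_suppSub.1 (y b).2).2 i hi

/-- Rank-nullity for `f`, `g` and `g` restricted to `ker f`. In use, `f` is a local projection and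
`g` the projection of the behavior onto the code. -/
lemma finrank_range_le_add {E A D : Type*} [AddCommGroup E] [Module F E]
    [FiniteDimensional F E] [AddCommGroup A] [Module F A] [AddCommGroup D] [Module F D]
    (f : E →ₗ[F] A) (g : E →ₗ[F] D) :
    Module.finrank F (LinearMap.range g) ≤
      Module.finrank F (LinearMap.range f) + Module.finrank F ((LinearMap.ker f).map g) := by
  have h1 := f.finrank_range_add_finrank_ker
  have h2 := g.finrank_range_add_finrank_ker
  have h3 := (g.domRestrict (LinearMap.ker f)).finrank_range_add_finrank_ker
  rw [LinearMap.range_domRestrict] at h3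
  have h4 : Module.finrank F (LinearMap.ker (g.domRestrict (LinearMap.ker f))) ≤
      Module.finrank F (LinearMap.ker g) := by
    let φ : LinearMap.ker (g.domRestrict (LinearMap.ker f)) →ₗ[F] LinearMap.ker g :=
      LinearMap.codRestrict _ ((LinearMap.ker f).subtype ∘ₗ Submodule.subtype _)
        fun x => x.2
    refine LinearMap.finrank_le_finrank_of_injective (f := φ) ?_
    intro x y h
    exact Subtype.ext (Subtype.ext (congrArg (fun t : LinearMap.ker g => (t : E)) h))
  omega

end Codes

/-! ### Branches at a vertex, and medians of paths -/

section Trees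

variable {W : Type*} {T : SimpleGraph W}

lemma Branch.verts_disjoint {z : W} {b c : Branch T z} {x : W} (hb : x ∈ b.verts)
    (hc : x ∈ c.verts) : b = c := by
  obtain ⟨y, hy, rfl⟩ := hb
  obtain ⟨y', hy', h⟩ := hc
  obtain rfl := Subtype.ext h
  exact hy.symm.trans hy'

lemma Branch.notMem_verts {z : W} (b : Branch T z) : z ∉ b.verts := by
  rintro ⟨y, -, h⟩
  exact y.2 h

/-- The component of `T - z` that contains `x`. -/
def branchOf (T : SimpleGraph W) {z x : W} (h : x ≠ z) : Branch T z :=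
  (T.induce ({z}ᶜ : Set W)).connectedComponentMk ⟨x, h⟩

lemma mem_verts_branchOf {z x : W} (h : x ≠ z) : x ∈ (branchOf T h).verts :=
  ⟨⟨x, h⟩, rfl, rfl⟩

lemma Branch.mem_verts_of_adj {z x y : W} {b : Branch T z} (hx : x ∈ b.verts)
    (h : T.Adj x y) (hy : y ≠ z) : y ∈ b.verts := by
  obtain ⟨x', hx', rfl⟩ := hx
  refine ⟨⟨y, hy⟩, ?_, rfl⟩
  rw [SimpleGraph.ConnectedComponent.mem_supp_iff] at hx' ⊢
  rw [← hx']
  exact SimpleGraph.ConnectedComponent.sound (SimpleGraph.Adj.reachable (by simpa using h.symm))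

/-- A walk inside a branch at `z` avoids `z`, hence every edge incident with `z`. -/
lemma Branch.connectedComponentMk_deleteEdges_eq {z x y : W} {b : Branch T z} (hx : x ∈ b.verts)
    (hy : y ∈ b.verts) {e : Sym2 W} (he : z ∈ e) :
    (T.deleteEdges {e}).connectedComponentMk x = (T.deleteEdges {e}).connectedComponentMk y := by
  obtain ⟨x', hx', rfl⟩ := hx
  obtain ⟨y', hy', rfl⟩ := hy
  have h := SimpleGraph.ConnectedComponent.exact (hx'.trans hy'.symm)
  let φ : (T.induce ({z}ᶜ : Set W)) →g T.deleteEdges {e} :=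
    { toFun := Subtype.val
      map_rel' := by
        rintro ⟨a, ha⟩ ⟨c, hc⟩ hac
        rw [SimpleGraph.deleteEdges_adj]
        refine ⟨by simpa using hac, ?_⟩
        rintro rfl
        rcases Sym2.mem_iff.1 he with rfl | rfl
        · exact ha rfl
        · exact hc rfl }
  exact SimpleGraph.ConnectedComponent.sound (h.map φ)

lemma exists_path_first_mem {a b : W} (p : T.Walk a b) (A : Set W) (hb : b ∈ A) :
    ∃ m ∈ A, ∃ q : T.Walk a m, (∀ x ∈ q.support, x ∈ p.support) ∧
      (∀ x ∈ q.support, x ∈ A → x = m) ∧ (p.IsPath → q.IsPath) := by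
  induction p with
  | nil => exact ⟨_, hb, .nil, by simp, by simp, by simp⟩
  | @cons u v w h p ih =>
    by_cases hu : u ∈ A
    · exact ⟨u, hu, .nil, by simp, by simp, by simp⟩
    · obtain ⟨m, hm, q, h1, h2, h3⟩ := ih hb
      refine ⟨m, hm, .cons h q, ?_, ?_, ?_⟩
      · intro x hx
        rw [SimpleGraph.Walk.support_cons, List.mem_cons] at hx ⊢
        exact hx.imp_right (h1 x)
      · intro x hx hxA
        rw [SimpleGraph.Walk.support_cons, List.mem_cons] at hx
        rcases hx with rfl | hx
        · exact absurd hxA hu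
        · exact h2 x hx hxA
      · rw [SimpleGraph.Walk.cons_isPath_iff, SimpleGraph.Walk.cons_isPath_iff]
        exact fun hp => ⟨h3 hp.1, fun hq => hp.2 (h1 _ hq)⟩

lemma isPath_append {a b c : W} {p : T.Walk a b} {q : T.Walk b c} (hp : p.IsPath)
    (hq : q.IsPath) (h : ∀ x ∈ p.support, x ∈ q.support → x = b) : (p.append q).IsPath := by
  rw [SimpleGraph.Walk.isPath_def, SimpleGraph.Walk.support_append, List.nodup_append']
  have hq' := hq.support_nodup
  rw [← SimpleGraph.Walk.cons_tail_support] at hq'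
  refine ⟨hp.support_nodup, (List.nodup_cons.1 hq').2, ?_⟩
  intro x hx hx'
  have := h x hx (List.mem_of_mem_tail hx')
  subst this
  exact (List.nodup_cons.1 hq').1 hx'

/-- Three vertices joined by paths `p` and `q` to a common end have a median. -/
lemma exists_median {a b r : W} {p : T.Walk a r} (hp : p.IsPath) {q : T.Walk b r}
    (hq : q.IsPath) : ∃ m, m ∈ p.support ∧ m ∈ q.support ∧
      ∃ s : T.Walk a b, s.IsPath ∧ m ∈ s.support := by
  classical
  obtain ⟨m, hm, p', h1, h2, h3⟩ := exists_path_first_mem p {x | x ∈ q.support} (by simp)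
  have hm' : m ∈ q.support := hm
  refine ⟨m, h1 m (by simp), hm, p'.append (q.takeUntil m hm').reverse, ?_, ?_⟩
  · refine isPath_append (h3 hp) (hq.takeUntil hm').reverse ?_
    intro x hx hx'
    refine h2 x hx ?_
    rw [SimpleGraph.Walk.support_reverse, List.mem_reverse] at hx'
    exact SimpleGraph.Walk.support_takeUntil_subset_support _ _ hx'
  · simp [SimpleGraph.Walk.mem_support_append_iff]

end Trees

/-! ### The sets `α(z)` partition the vertices of the graph -/

section VertexCutTrees

variable {V W : Type*} {G : SimpleGraph V} {T : SimpleGraph W} {β : W → Set V}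

lemma alpha_subset (zs z : W) : alpha T β zs z ⊆ β z := Set.sdiff_subset

/-- The `z` with `v ∈ β z` span a subtree; `v ∈ α(z)` singles out its vertex nearest to `z*`. -/
lemma IsVertexCutTree.existsUnique_mem_alpha (h : IsVertexCutTree G T β) (zs : W) (v : V) :
    ∃! z : W, v ∈ alpha T β zs z := by
  classical
  have hconn : ∀ x y : W, ∃ p : T.Walk x y, p.IsPath := fun x y =>
    ⟨_, (h.isTree.connected.preconnected x y).some.toPath.2⟩
  have hne : ∃ z, v ∈ β z := by
    have : v ∈ ⋃ z, β z := by rw [h.cover]; trivial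
    simpa using this
  refine existsUnique_of_exists_of_unique ?_ ?_
  · obtain ⟨z₀, hz₀⟩ := hne
    obtain ⟨p, hp⟩ := hconn zs z₀
    obtain ⟨m, hm, q, -, h2, h3⟩ := exists_path_first_mem p {x | v ∈ β x} hz₀
    refine ⟨m, hm, ?_⟩
    simp only [Set.mem_iUnion, not_exists]
    rintro y ⟨hy, p', hp', hyp⟩ hvy
    have : p'.reverse = q := congrArg Subtype.val
      ((h.isTree.isAcyclic.subsingleton_path _ _).elim
        ⟨p'.reverse, hp'.reverse⟩ ⟨q, h3 hp⟩)
    refine hy (h2 y ?_ hvy)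
    rw [← this]
    simpa using hyp
  · intro a b ha hb
    obtain ⟨p, hp⟩ := hconn a zs
    obtain ⟨q, hq⟩ := hconn b zs
    -- The median of `a`, `b`, `zs` also has `v` in its bag, and it lies on both paths to `zs`; so
    -- it equals both `a` and `b`.
    obtain ⟨m, hmp, hmq, s, hs, hms⟩ := exists_median hp hq
    have hvm : v ∈ β m := h.inter_subset a b m s hs hms ⟨ha.1, hb.1⟩
    have key : ∀ (z : W) (r : T.Walk z zs), r.IsPath → m ∈ r.support →
        v ∈ alpha T β zs z → m = z := by
      intro z r hr hmr hz
      by_contra hne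
      exact hz.2 (Set.mem_biUnion (show m ∈ pathIoc T z zs from ⟨hne, r, hr, hmr⟩) hvm)
    exact (key a p hp hmp ha).symm.trans (key b q hq hmq hb)

/-- Otherwise `v` would lie in the parts of two distinct branches, which are disjoint. This gives
`ω⁻¹(V_b) ⊆ γ⁻¹(b)`. -/
lemma IsVertexCutTree.mem_verts_of_mem_part (h : IsVertexCutTree G T β) {z x : W} {v : V}
    {c : Branch T z} (hv : v ∈ part T β z c) (hx : v ∈ β x) : x ∈ c.verts := by
  have hxz : x ≠ z := by
    rintro rfl
    exact hv.2 hx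
  have hv' : v ∈ part T β z (branchOf T hxz) :=
    ⟨Set.mem_biUnion (mem_verts_branchOf hxz) hx, hv.2⟩
  have : branchOf T hxz = c := by
    by_contra hne
    exact ((h.star z).pairwise_disjoint hne).le_bot ⟨hv', hv⟩
  exact this ▸ mem_verts_branchOf hxz

/-- Since `zs` lies in `(x, zs]`, the bag of `zs` has been removed from `α(x)`. This gives the
reverse inclusion at `zs`. -/
lemma IsVertexCutTree.mem_part_of_mem_alpha (h : IsVertexCutTree G T β) {zs x : W} {v : V}
    {c : Branch T zs} (hx : x ∈ c.verts) (hv : v ∈ alpha T β zs x) : v ∈ part T β zs c := by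
  classical
  refine ⟨Set.mem_biUnion hx hv.1, fun hzs => ?_⟩
  refine hv.2 (Set.mem_biUnion (x := zs) ⟨?_, ?_⟩ hzs)
  · rintro rfl
    exact c.notMem_verts hx
  · obtain ⟨p, hp⟩ := (h.isTree.connected.preconnected x zs).some.toPath
    exact ⟨p, hp, p.end_mem_support⟩

end VertexCutTrees

/-! ### Gluing codewords along a tree -/

section Gluing

variable {F : Type*} [Field F] {I W : Type*}

/-- The codewords all of whose restrictions to the components of `T - e` are codewords. -/
noncomputable def edgeSub (C : Submodule F (I → F)) (T : SimpleGraph W) (γ : I → W)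
    (e : Sym2 W) : Submodule F (I → F) :=
  ⨅ D : (T.deleteEdges {e}).ConnectedComponent,
    C.comap (restrictTo F {i | (T.deleteEdges {e}).connectedComponentMk (γ i) = D})

lemma mem_edgeSub {C : Submodule F (I → F)} {T : SimpleGraph W} {γ : I → W} {e : Sym2 W}
    {x : I → F} : x ∈ edgeSub C T γ e ↔ ∀ D : (T.deleteEdges {e}).ConnectedComponent,
      restrictTo F {i | (T.deleteEdges {e}).connectedComponentMk (γ i) = D} x ∈ C := by
  simp [edgeSub, Submodule.mem_iInf]

/-- `A` contains every edge across which the family `c` jumps. The induction removes one jump at a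
time; without jumps the family is constant. -/
lemma glue_mem_aux {C : Submodule F (I → F)} {T : SimpleGraph W} (hT : T.IsTree) {γ : I → W}
    (A : Finset (Sym2 W)) : ∀ c : W → I → F, (∀ v, c v ∈ C) →
    (∀ v w, T.Adj v w → c v - c w ∈ edgeSub C T γ s(v, w)) →
    (∀ v w, T.Adj v w → s(v, w) ∉ A → c v = c w) → (fun i => c (γ i) i) ∈ C := by
  classical
  induction A using Finset.induction_on with
  | empty =>
    intro c hC _ heq
    obtain ⟨r⟩ := hT.connected.nonempty
    have h : ∀ v, c v = c r := by
      intro v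
      obtain ⟨p⟩ := hT.connected.preconnected v r
      induction p with
      | nil => rfl
      | cons h _ ih => exact (heq _ _ h (by simp)).trans ih
    simpa only [h] using hC r
  | insert e A _ ih =>
    intro c hC hK heq
    by_cases he : e ∈ T.edgeSet
    swap
    · refine ih c hC hK fun v w hvw hA => heq v w hvw ?_
      rw [Finset.mem_insert, not_or]
      refine ⟨?_, hA⟩
      rintro rfl
      exact he hvw
    induction e using Sym2.ind with | _ a b => ?_
    have hab : T.Adj a b := he
    let T' := T.deleteEdges {s(a, b)}
    let D := T'.connectedComponentMk b
    have hD : T'.connectedComponentMk a ≠ D := by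
      intro h
      have := SimpleGraph.isAcyclic_iff_forall_adj_isBridge.1 hT.isAcyclic hab
      rw [SimpleGraph.isBridge_iff] at this
      exact this (SimpleGraph.ConnectedComponent.exact h)
    have hadj : ∀ v w, T.Adj v w → s(v, w) ≠ s(a, b) →
        T'.connectedComponentMk v = T'.connectedComponentMk w := fun v w hvw hne =>
      SimpleGraph.ConnectedComponent.sound
        (SimpleGraph.Adj.reachable (SimpleGraph.deleteEdges_adj.2 ⟨hvw, hne⟩))
    let d := c b - c a
    -- Subtracting the jump `d` on the far side of the bridge `s(a, b)` removes the jump there and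
    -- alters no other difference. The glued word changes by the restriction of `d` to that side, a
    -- codeword because `d` lies in `edgeSub`.
    let c' : W → I → F := fun u => if T'.connectedComponentMk u = D then c u - d else c u
    have hd : restrictTo F {i | T'.connectedComponentMk (γ i) = D} d ∈ C := by
      have := mem_edgeSub.1 (hK b a hab.symm)
      rw [Sym2.eq_swap] at this
      exact this D
    have hca : c' a = c a := if_neg hD
    have hcb : c' b = c a := (if_pos rfl).trans (sub_sub_cancel _ _)
    have hc' : ∀ v w, T.Adj v w → s(v, w) ≠ s(a, b) → c' v - c' w = c v - c w := by
      intro v w hvw hne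
      simp only [c', hadj v w hvw hne]
      split_ifs
      · abel
      · rfl
    have hc'' : ∀ v w, s(v, w) = s(a, b) → c' v = c' w := by
      intro v w h
      rcases Sym2.eq_iff.1 h with ⟨rfl, rfl⟩ | ⟨rfl, rfl⟩
      · rw [hca, hcb]
      · rw [hca, hcb]
    have hx' := ih c' ?_ ?_ ?_
    · have : (fun i => c (γ i) i) = (fun i => c' (γ i) i) +
          restrictTo F {i | T'.connectedComponentMk (γ i) = D} d := by
        funext i
        by_cases hi : T'.connectedComponentMk (γ i) = D
        · rw [Pi.add_apply, restrictTo_of_mem _ (by exact hi)]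
          simp [c', hi]
        · rw [Pi.add_apply, restrictTo_of_notMem _ (by exact hi)]
          simp [c', hi]
      rw [this]
      exact C.add_mem hx' hd
    · intro v
      simp only [c']
      split_ifs
      · exact C.sub_mem (hC v) (C.sub_mem (hC b) (hC a))
      · exact hC v
    · intro v w hvw
      by_cases h : s(v, w) = s(a, b)
      · rw [hc'' v w h, sub_self]
        exact Submodule.zero_mem _
      · rw [hc' v w hvw h]
        exact hK v w hvw
    · intro v w hvw hA
      by_cases h : s(v, w) = s(a, b)
      · exact hc'' v w h
      · refine sub_eq_zero.1 ((hc' v w hvw h).trans (sub_eq_zero.2 (heq v w hvw ?_)))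
        rw [Finset.mem_insert, not_or]
        exact ⟨h, hA⟩

/-- Codewords indexed by the vertices of a tree that agree at each edge `e` modulo
`edgeSub C T γ e` glue to a codeword. -/
lemma glue_mem [Finite W] {C : Submodule F (I → F)} {T : SimpleGraph W} (hT : T.IsTree)
    {γ : I → W} {c : W → I → F} (hC : ∀ v, c v ∈ C)
    (hK : ∀ v w, T.Adj v w → c v - c w ∈ edgeSub C T γ s(v, w)) :
    (fun i => c (γ i) i) ∈ C := by
  classical
  have := Fintype.ofFinite (Sym2 W)
  exact glue_mem_aux hT Finset.univ c hC hK fun v w _ h => absurd (Finset.mem_univ _) h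

end Gluing

/-! ### Optimal realizations over a tree -/

section Realizations

universe u

variable {F : Type u} [Field F] {I W : Type*}

/-- Coordinates on the quotient by `K`; the target `Fin n → F` stays in the universe of `F`, as a
state space must. -/
lemma exists_surjective_ker_eq {M : Type*} [AddCommGroup M] [Module F M] [FiniteDimensional F M]
    (K : Submodule F M) : ∃ (n : ℕ) (σ : M →ₗ[F] (Fin n → F)),
      Function.Surjective σ ∧ LinearMap.ker σ = K := by
  let E := (Module.finBasis F (M ⧸ K)).equivFun
  refine ⟨_, E.toLinearMap ∘ₗ K.mkQ, E.surjective.comp K.mkQ_surjective, ?_⟩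
  rw [LinearEquiv.ker_comp, Submodule.ker_mkQ]

namespace GraphicalModel

variable {T : SimpleGraph W} {γ : I → W}

lemma mem_behavior {Γ : GraphicalModel F T γ} {y : Γ.GlobalConfig} :
    y ∈ Γ.behavior ↔ ∀ v, Γ.localProj v y ∈ Γ.C v := by
  simp [behavior, Submodule.mem_iInf]

/-- The local configuration at `v` that a codeword determines by way of the state maps. -/
def stateMapLocal {C : Submodule F (I → F)} {n : T.edgeSet → ℕ}
    (σ : ∀ e, C →ₗ[F] (Fin (n e) → F)) (v : W) :
    C →ₗ[F] ({i : I // γ i = v} → F) ×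
      (∀ e : {e : T.edgeSet // v ∈ (e : Sym2 W)}, Fin (n e.1) → F) :=
  LinearMap.prod (LinearMap.funLeft F F Subtype.val ∘ₗ C.subtype)
    (LinearMap.pi fun e => σ e.1)

/-- The graphical model whose local constraints are the local configurations determined by
the codewords by way of the state maps. -/
def ofStateMaps (γ : I → W) {C : Submodule F (I → F)} {n : T.edgeSet → ℕ}
    (σ : ∀ e, C →ₗ[F] (Fin (n e) → F)) : GraphicalModel F T γ where
  S e := Fin (n e) → F
  C v := LinearMap.range (stateMapLocal (γ := γ) σ v)

lemma ofStateMaps_mem_behavior {C : Submodule F (I → F)} {n : T.edgeSet → ℕ}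
    (σ : ∀ e, C →ₗ[F] (Fin (n e) → F)) (c : C) :
    (((c : I → F), fun e => σ e c) : (ofStateMaps γ σ).GlobalConfig) ∈
      (ofStateMaps γ σ).behavior :=
  mem_behavior.2 fun _ => ⟨c, rfl⟩

/-- In a valid configuration each vertex has its own witnessing codeword. Witnesses at adjacent
vertices share a state, so they differ by an element of `edgeSub`, and they glue. -/
lemma ofStateMaps_isRealization [Finite W] (hT : T.IsTree) {C : Submodule F (I → F)}
    {n : T.edgeSet → ℕ} {σ : ∀ e, C →ₗ[F] (Fin (n e) → F)}
    (hsurj : ∀ e, Function.Surjective (σ e))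
    (hker : ∀ e, LinearMap.ker (σ e) ≤ (edgeSub C T γ e).comap C.subtype) :
    (ofStateMaps γ σ).IsRealization C := by
  refine ⟨⟨fun v => le_antisymm ?_ ?_, fun e => top_le_iff.1 ?_⟩, le_antisymm ?_ ?_⟩
  · rintro _ ⟨y, hy, rfl⟩
    exact mem_behavior.1 hy v
  · rintro _ ⟨c, rfl⟩
    exact ⟨_, ofStateMaps_mem_behavior σ c, rfl⟩
  · intro s _
    obtain ⟨c, rfl⟩ := hsurj e s
    exact ⟨_, ofStateMaps_mem_behavior σ c, rfl⟩
  · rintro _ ⟨⟨x, s⟩, hy, rfl⟩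
    have hloc := mem_behavior.1 hy
    choose c hc using hloc
    have hx : ∀ v (i : {i // γ i = v}), (c v : I → F) i = x i := fun v i =>
      congrFun (congrArg Prod.fst (hc v)) i
    have hs : ∀ v (e : {e : T.edgeSet // v ∈ (e : Sym2 W)}), σ e.1 (c v) = s e.1 := fun v e =>
      congrFun (congrArg Prod.snd (hc v)) e
    have hglue := glue_mem (γ := γ) hT (c := fun v => (c v : I → F)) (fun v => (c v).2) ?_
    · have : (fun i => (c (γ i) : I → F) i) = x := funext fun i => hx (γ i) ⟨i, rfl⟩
      exact this ▸ hglue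
    · intro v w hvw
      let e : T.edgeSet := ⟨s(v, w), hvw⟩
      refine hker e (x := c v - c w) ?_
      rw [LinearMap.mem_ker, map_sub, sub_eq_zero]
      exact (hs v ⟨e, Sym2.mem_mk_left v w⟩).trans (hs w ⟨e, Sym2.mem_mk_right v w⟩).symm
  · intro x hx
    exact ⟨_, ofStateMaps_mem_behavior σ ⟨x, hx⟩, rfl⟩

/-- Codewords supported on a single branch at `v` are sent to zero by the local map at `v`, so its
kernel contains their direct sum. -/
lemma ofStateMaps_finrank_add_le [Finite I] {C : Submodule F (I → F)}
    {n : T.edgeSet → ℕ} {σ : ∀ e, C →ₗ[F] (Fin (n e) → F)}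
    (hker : ∀ e : T.edgeSet, (edgeSub C T γ e).comap C.subtype ≤ LinearMap.ker (σ e)) (v : W)
    [Fintype (Branch T v)] :
    Module.finrank F ((ofStateMaps γ σ).C v) +
      ∑ b : Branch T v, Module.finrank F (crossSection C (γ ⁻¹' b.verts)) ≤
        Module.finrank F C := by
  classical
  have hdisj : Pairwise fun a b : Branch T v =>
      Disjoint (γ ⁻¹' a.verts) (γ ⁻¹' b.verts) := fun a b hab =>
    Set.disjoint_left.2 fun i ha hb => hab (Branch.verts_disjoint ha hb)
  rw [← finrank_range_sumSupp C hdisj,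
    ← (stateMapLocal (γ := γ) σ v).finrank_range_add_finrank_ker]
  refine Nat.add_le_add_left ?_ _
  rw [← Submodule.finrank_map_subtype_eq C]
  refine Submodule.finrank_mono ?_
  rintro _ ⟨y, rfl⟩
  rw [sumSupp_apply]
  refine Submodule.sum_mem _ fun b _ => ?_
  obtain ⟨y, hy⟩ := y b
  rw [mem_suppSub] at hy
  refine ⟨⟨y, hy.1⟩, ?_, rfl⟩
  refine LinearMap.mem_ker.2 (Prod.ext (funext ?_) (funext ?_))
  · rintro ⟨i, rfl⟩
    exact hy.2 i fun h => b.notMem_verts h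
  · rintro ⟨e, he⟩
    refine hker e (x := ⟨y, hy.1⟩) (mem_edgeSub.2 fun D => ?_)
    -- The branch lies in a single component of `T - e`, so each restriction of `y` is `y` or zero.
    by_cases hD : ∃ w ∈ b.verts, (T.deleteEdges {(e : Sym2 W)}).connectedComponentMk w = D
    · obtain ⟨w, hw, rfl⟩ := hD
      convert hy.1 using 1
      funext i
      by_cases hi : (T.deleteEdges {(e : Sym2 W)}).connectedComponentMk (γ i) =
          (T.deleteEdges {(e : Sym2 W)}).connectedComponentMk w
      · exact restrictTo_of_mem _ (by exact hi)
      · refine (restrictTo_of_notMem _ (by exact hi)).trans (hy.2 i fun h => hi ?_).symm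
        exact Branch.connectedComponentMk_deleteEdges_eq h hw he
    · convert C.zero_mem using 1
      funext i
      by_cases hi : (T.deleteEdges {(e : Sym2 W)}).connectedComponentMk (γ i) = D
      · exact (restrictTo_of_mem _ (by exact hi)).trans (hy.2 i fun h => hD ⟨_, h, hi⟩)
      · exact restrictTo_of_notMem _ (by exact hi)

open Classical in
/-- The part of a global configuration carried by a set `A` of vertices: the symbols at the
vertices of `A` and the states at the edges that meet `A`. -/
noncomputable def cut (Γ : GraphicalModel F T γ) (A : Set W) (y : Γ.GlobalConfig) :
    Γ.GlobalConfig :=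
  (restrictTo F (γ ⁻¹' A) y.1, fun e => if ∃ u ∈ A, u ∈ (e : Sym2 W) then y.2 e else 0)

/-- At vertices of the branch nothing changes. Elsewhere the local configuration becomes zero: an
edge leaving the branch ends at `v`, where all states vanish. -/
lemma cut_mem_behavior {Γ : GraphicalModel F T γ} {v : W} (b : Branch T v)
    {y : Γ.GlobalConfig} (hy : y ∈ Γ.behavior) (hv : Γ.localProj v y = 0) :
    Γ.cut b.verts y ∈ Γ.behavior := by
  rw [mem_behavior] at hy ⊢
  intro u
  by_cases hu : u ∈ b.verts
  · convert hy u using 1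
    refine Prod.ext (funext ?_) (funext ?_)
    · rintro ⟨i, rfl⟩
      exact restrictTo_of_mem _ hu
    · rintro ⟨e, he⟩
      exact if_pos ⟨u, hu, he⟩
  · convert (Γ.C u).zero_mem using 1
    refine Prod.ext (funext ?_) (funext ?_)
    · rintro ⟨i, rfl⟩
      exact restrictTo_of_notMem _ hu
    · rintro ⟨e, he⟩
      by_cases h : ∃ w ∈ b.verts, w ∈ (e : Sym2 W)
      · refine (if_pos h).trans ?_
        obtain ⟨w, hw, hwe⟩ := h
        have hwu : w ≠ u := fun h => hu (h ▸ hw)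
        have hee : (e : Sym2 W) = s(w, u) := (Sym2.mem_and_mem_iff hwu).1 ⟨hwe, he⟩
        have hadj : T.Adj w u := by
          have := e.2
          rwa [hee] at this
        have huv : u = v := by
          by_contra hne
          exact hu (Branch.mem_verts_of_adj hw hadj hne)
        subst huv
        exact congrFun (congrArg Prod.snd hv) ⟨e, he⟩
      · exact if_neg h

/-- By the rank inequality it suffices to treat configurations that vanish at `v`; the word of such
a configuration is the sum of its cuts to the branches, each a codeword. -/
lemma IsRealization.finrank_le_add [Finite I] [Finite W] {Γ : GraphicalModel F T γ}
    {C : Submodule F (I → F)} (hΓ : Γ.IsRealization C) (v : W) [Fintype (Branch T v)] :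
    Module.finrank F C ≤ Module.finrank F (Γ.C v) +
      ∑ b : Branch T v, Module.finrank F (crossSection C (γ ⁻¹' b.verts)) := by
  classical
  have hdisj : Pairwise fun a b : Branch T v =>
      Disjoint (γ ⁻¹' a.verts) (γ ⁻¹' b.verts) := fun a b hab =>
    Set.disjoint_left.2 fun i ha hb => hab (Branch.verts_disjoint ha hb)
  have hrank := finrank_range_le_add ((Γ.localProj v).domRestrict Γ.behavior)
    ((LinearMap.fst F (I → F) (∀ e : T.edgeSet, Γ.S e)).domRestrict Γ.behavior)
  rw [LinearMap.range_domRestrict, LinearMap.range_domRestrict, hΓ.1.1 v, hΓ.2] at hrank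
  rw [← finrank_range_sumSupp C hdisj]
  refine hrank.trans (Nat.add_le_add_left (Submodule.finrank_mono ?_) _)
  rintro _ ⟨⟨y, hy⟩, hv, rfl⟩
  have hv' : Γ.localProj v y = 0 := hv
  have hcut : ∀ b : Branch T v, restrictTo F (γ ⁻¹' b.verts) y.1 ∈
      suppSub C (γ ⁻¹' b.verts) := fun b =>
    mem_suppSub.2 ⟨hΓ.2 ▸ ⟨_, cut_mem_behavior b hy hv', rfl⟩,
      fun i hi => restrictTo_of_notMem _ hi⟩
  refine ⟨fun b => ⟨_, hcut b⟩, ?_⟩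
  rw [sumSupp_apply]
  funext i
  rw [Finset.sum_apply]
  change ∑ b : Branch T v, restrictTo F (γ ⁻¹' b.verts) y.1 i = y.1 i
  by_cases hi : γ i = v
  · refine (Finset.sum_eq_zero fun b _ => restrictTo_of_notMem _ ?_).trans
      (congrFun (congrArg Prod.fst hv') ⟨i, hi⟩).symm
    subst hi
    exact b.notMem_verts
  · rw [Finset.sum_eq_single (branchOf T hi)]
    · exact restrictTo_of_mem _ (mem_verts_branchOf hi)
    · intro b _ hb
      exact restrictTo_of_notMem _ fun h => hb (Branch.verts_disjoint h (mem_verts_branchOf hi))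
    · simp

end GraphicalModel

/-- Over a tree, some realization has, at every vertex, a local constraint of dimension at most
`dim C` less the dimensions of the cross-sections at the branches. -/
lemma exists_realization_finrank_add_le [Finite I] [Finite W] {T : SimpleGraph W}
    (hT : T.IsTree) (C : Submodule F (I → F)) (γ : I → W) :
    ∃ Γ ∈ realizations C T γ, ∀ (v : W) [Fintype (Branch T v)],
      Module.finrank F (Γ.C v) +
        ∑ b : Branch T v, Module.finrank F (crossSection C (γ ⁻¹' b.verts)) ≤
          Module.finrank F C := by
  choose n σ hsurj hker using fun e : T.edgeSet =>
    exists_surjective_ker_eq ((edgeSub C T γ e).comap C.subtype)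
  exact ⟨_, GraphicalModel.ofStateMaps_isRealization hT hsurj fun e => (hker e).le,
    fun v _ => GraphicalModel.ofStateMaps_finrank_add_le (fun e => (hker e).ge) v⟩

end Realizations

/-! ### Comparison of `μ` with `κ` -/

section VertexCutTrees

variable {F : Type*} [Field F] {I V W : Type*} {G : SimpleGraph V} {T : SimpleGraph W}
  {β : W → Set V}

lemma IsVertexCutTree.mVal_eq_mu_realizations [Finite I] [Finite W]
    (h : IsVertexCutTree G T β) (C : Submodule F (I → F)) (ω : I → V) {zs : W}
    (hzs : mVal C T ω β zs = mu C T ω β) {γ : I → W}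
    (hγ : ∀ i, ω i ∈ alpha T β zs (γ i)) :
    (realizations C T γ).Nonempty ∧ mu C T ω β = (kappa C T γ : ℤ) := by
  classical
  have : ∀ v, Fintype (Branch T v) := fun v => Fintype.ofFinite _
  obtain ⟨Γ₀, hΓ₀, hle⟩ := exists_realization_finrank_add_le h.isTree C γ
  have : Nonempty W := ⟨zs⟩
  have hm : ∀ z, mVal C T ω β z ≤ mu C T ω β := fun z =>
    le_ciSup (Set.finite_range _).bddAbove z
  have hsub : ∀ z (c : Branch T z), ω ⁻¹' part T β z c ⊆ γ ⁻¹' c.verts := fun z c i hi =>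
    h.mem_verts_of_mem_part hi (alpha_subset _ _ (hγ i))
  have hsub' : ∀ c : Branch T zs, ω ⁻¹' part T β zs c = γ ⁻¹' c.verts := fun c =>
    (hsub zs c).antisymm fun i hi => h.mem_part_of_mem_alpha hi (hγ i)
  have hsum : ∀ z, mVal C T ω β z = (Module.finrank F C : ℤ) -
      ((∑ c : Branch T z, Module.finrank F (crossSection C (ω ⁻¹' part T β z c)) : ℕ) : ℤ) := by
    intro z
    rw [mVal, finsum_eq_sum_of_fintype, Nat.cast_sum]
  refine ⟨⟨Γ₀, hΓ₀⟩, le_antisymm ?_ ?_⟩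
  -- The infimum defining `κ` is attained, as the set is nonempty; the lower bound at `zs` for this
  -- realization gives `μ ≤ κ`.
  · obtain ⟨Γ, hΓ, hk⟩ := Nat.sInf_mem (Set.Nonempty.image GraphicalModel.kappa ⟨Γ₀, hΓ₀⟩)
    have h1 : Module.finrank F (Γ.C zs) ≤ kappa C T γ :=
      (le_ciSup (f := fun v => Module.finrank F (Γ.C v)) (Set.finite_range _).bddAbove zs).trans
        hk.le
    have h2 := GraphicalModel.IsRealization.finrank_le_add hΓ zs
    have h3 : ∑ c : Branch T zs, Module.finrank F (crossSection C (ω ⁻¹' part T β zs c)) =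
        ∑ b : Branch T zs, Module.finrank F (crossSection C (γ ⁻¹' b.verts)) :=
      Finset.sum_congr rfl fun c _ => by rw [hsub' c]
    rw [← hzs, hsum, h3]
    omega
  · have h1 : kappa C T γ ≤ Γ₀.kappa := Nat.sInf_le ⟨Γ₀, hΓ₀, rfl⟩
    -- At a vertex `v` where `Γ₀` has its largest constraint, that dimension is at most `m(v) ≤ μ`.
    obtain ⟨v, hv⟩ := exists_eq_ciSup_of_finite (f := fun v => Module.finrank F (Γ₀.C v))
    have h2 := hle v
    have h3 : ∑ c : Branch T v, Module.finrank F (crossSection C (ω ⁻¹' part T β v c)) ≤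
        ∑ b : Branch T v, Module.finrank F (crossSection C (γ ⁻¹' b.verts)) := by
      refine Finset.sum_le_sum fun c _ => ?_
      rw [finrank_crossSection, finrank_crossSection]
      exact Submodule.finrank_mono (suppSub_mono C (hsub v c))
    have h4 : Module.finrank F (Γ₀.C v) = Γ₀.kappa := hv
    have h5 := hm v
    rw [hsum] at h5
    omega

end VertexCutTrees

end CodeGraph

theorem mainTheorem9 {F : Type*} [Field F] [Finite F] {I V W : Type*} [Finite I] [Finite V]
    [Finite W] (C : Submodule F (I → F)) (G : SimpleGraph V) (hG : G.Connected) (ω : I → V)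
    (T : SimpleGraph W) (β : W → Set V) (hβ : CodeGraph.IsVertexCutTree G T β) :
    (∃ γ : I → W, (CodeGraph.realizations C T γ).Nonempty ∧
      CodeGraph.mu C T ω β = (CodeGraph.kappa C T γ : ℤ)) ∧
    (∃ zs : W, CodeGraph.mVal C T ω β zs = CodeGraph.mu C T ω β) ∧
    ∀ zs : W, CodeGraph.mVal C T ω β zs = CodeGraph.mu C T ω β →
      (∀ v : V, ∃! z : W, v ∈ CodeGraph.alpha T β zs z) ∧
      ∀ γ : I → W, (∀ i : I, ω i ∈ CodeGraph.alpha T β zs (γ i)) →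
        (CodeGraph.realizations C T γ).Nonempty ∧
          CodeGraph.mu C T ω β = (CodeGraph.kappa C T γ : ℤ) := by
  have := hβ.isTree.connected.nonempty
  obtain ⟨zs, hzs⟩ : ∃ zs : W, CodeGraph.mVal C T ω β zs = CodeGraph.mu C T ω β :=
    exists_eq_ciSup_of_finite
  refine ⟨?_, ⟨zs, hzs⟩, fun z hz => ⟨hβ.existsUnique_mem_alpha z, fun γ hγ =>
    hβ.mVal_eq_mu_realizations C ω hz hγ⟩⟩
  choose α hα using fun v => (hβ.existsUnique_mem_alpha zs v).exists
  exact ⟨fun i => α (ω i), hβ.mVal_eq_mu_realizations C ω hzs fun i => hα (ω i)⟩
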